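/- All logarithms are to base $2$. A ternary point is an $x\in\{0,u,1\}^N$, a resolution of $x$ is a Boolean point obtained by replacing every $u$ in $x$ by $0$ or $1$, and gates act on $\{0,u,1\}$ by Kleene's three-valued logic. Formulas are trees of gates $\wedge,\vee$ (fan-in $2$) and $\neg$ whose leaves are input variables; the depth of a formula is the maximal number of $\wedge,\vee$ gates on a path from a leaf to the root (not counting negations; the lower bounds below then hold a fortiori if negations are counted). A formula is monotone if it has no $\neg$ gate. A formula $F$ is hazard-free if there is no ternary point $x$ at which $F(x)=u$ although $F$ takes the same Boolean value at all resolutions of $x$. For a Boolean function $f$ let $\mathrm{depth}_F^u(f)$ and $\mathrm{depth}_F^+(f)$ be the minimal depth of a hazard-free, respectively monotone, formula computing $f$. The hazard-derivative of $f$ at a Boolean point $x$ is the Boolean function $y\mapsto \mathrm{d}f(x;y)$ with $\mathrm{d}f(x;y)=1$ iff $f$ is not constant on the resolutions of the point obtained from $x$ by replacing $x_i$ by $u$ for all $i$ with $y_i=1$. Let $\mathrm{mux}_m:\{0,1\}^{m+2^m}\to\{0,1\}$, $\mathrm{mux}_m(s,x)=x_{s}$, be the multiplexer, where the data bits are indexed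 by $s\in\{0,1\}^m$. Let $MC_{k,n}:\{0,1\}^{n^2}\to\{0,1\}$ be the set covering function: its input is the edge set of a bipartite graph on $U\cup V$, $|U|=|V|=n$, and its value is $1$ iff there is $U'\subseteq U$ with $|U'|=k$ such that every $v\in V$ has a neighbour in $U'$. Let $(f\diamond g)(X)=f(g(X_1),\dots,g(X_N))$, where $X_1,\dots,X_N$ are the rows of $X$. **Proposition.** There are absolute constants $c_0,a,C>0$ such that for every real $c\in(0,c_0]$, all $n$ for which $k:=\lfloor c\log n\rfloor$ is at least $1$, and all $m\ge 0$, the following hold. 1. $\mathrm{depth}_F^u(MC_{k,n}\diamond \mathrm{mux}_m)$ is finite and $$\mathrm{depth}_F^u(MC_{k,n}\diamond \mathrm{mux}_m)\ \ge\ \log(3^m)+\log\binom{n}{k}\ \ge\ \log(3)\cdot m+a\,c(\log n)^2 .$$ 2. If $m\ge C\log n$, this bound breaks the monotone barrier, that is, it is stronger than every bound given by a hazard-derivative: for every Boolean point $x$, $$\mathrm{depth}_F^+\bigl(\mathrm{d}(MC_{k,n}\diamond \mathrm{mux}_m)(x;\cdot)\bigr)\ <\ \log(3^m)+\log\binom{n}{k}.$$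 -/

import Mathlib

namespace HazardFree

/-- Kleene's three values: `some false` is `0`, `some true` is `1`, `none` is the unstable value
`u`. -/
abbrev Ternary : Type := Option Bool

/-- Kleene conjunction. -/
def kAnd : Ternary → Ternary → Ternary
  | some false, _ => some false
  | _, some false => some false
  | some true, some true => some true
  | _, _ => none

/-- Kleene disjunction. -/
def kOr : Ternary → Ternary → Ternary
  | some true, _ => some true
  | _, some true => some true
  | some false, some false => some false
  | _, _ => none

/-- Kleene negation. -/
def kNot : Ternary → Ternary
  | some b => some (!b)
  | none => none

/-- A Boolean point, seen as a ternary point all of whose coordinates are stable. -/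
def stable {ι : Type} (y : ι → Bool) : ι → Ternary := fun i => some (y i)

/-- `y` is a resolution of `x`: it agrees with `x` on every stable coordinate of `x`. -/
def IsResolution {ι : Type} (x : ι → Ternary) (y : ι → Bool) : Prop :=
  ∀ i, x i = none ∨ x i = some (y i)

open Classical in
/-- The hazard-free extension of a Boolean function. -/
noncomputable def extension {ι : Type} (f : (ι → Bool) → Bool) (x : ι → Ternary) : Ternary :=
  if ∀ y, IsResolution x y → f y = false then some false
  else if ∀ y, IsResolution x y → f y = true then some true
  else none

/-- The point `x + u y`: the coordinates of `x` where `y` is `1` are made unstable. -/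
def perturb {ι : Type} (x y : ι → Bool) : ι → Ternary :=
  fun i => if y i = true then none else some (x i)

/-- The hazard-derivative `y ↦ df(x; y)` of the Boolean function `f` at the Boolean point `x`:
it is `1` exactly when the hazard-free extension of `f` is unstable at `x + u y`. -/
noncomputable def hazardDerivative {ι : Type} (f : (ι → Bool) → Bool) (x : ι → Bool) :
    (ι → Bool) → Bool :=
  fun y => decide (extension f (perturb x y) = none)

/-- De Morgan formulas whose leaves are labelled by input variables from `ι`. -/
inductive Formula (ι : Type) : Type
  | var : ι → Formula ι
  | neg : Formula ι → Formula ι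
  | and : Formula ι → Formula ι → Formula ι
  | or : Formula ι → Formula ι → Formula ι

namespace Formula

variable {ι : Type}

/-- Evaluation of a formula in Kleene's logic. -/
def eval : Formula ι → (ι → Ternary) → Ternary
  | var i, x => x i
  | neg F, x => kNot (F.eval x)
  | and F G, x => kAnd (F.eval x) (G.eval x)
  | or F G, x => kOr (F.eval x) (G.eval x)

/-- The depth of a formula: the largest number of fan-in two gates on a path from a leaf to the
root. Negations are not counted, as in the identification of formula depth with the communication
complexity of Karchmer-Wigderson games; a lower bound on this depth is also one on the depth in
which negations are counted. -/
def depth : Formula ι → ℕ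
  | var _ => 0
  | neg F => F.depth
  | and F G => max F.depth G.depth + 1
  | or F G => max F.depth G.depth + 1

/-- A formula is monotone if it has no negation gate. -/
def IsMonotone : Formula ι → Prop
  | var _ => True
  | neg _ => False
  | and F G => F.IsMonotone ∧ G.IsMonotone
  | or F G => F.IsMonotone ∧ G.IsMonotone

/-- The formula computes the Boolean function `f`. -/
def Computes (F : Formula ι) (f : (ι → Bool) → Bool) : Prop :=
  ∀ y, F.eval (stable y) = some (f y)

/-- The formula has a hazard at `x`: it is unstable at `x`, but takes one and the same Boolean
value at all the resolutions of `x`. -/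
def HasHazardAt (F : Formula ι) (x : ι → Ternary) : Prop :=
  F.eval x = none ∧ ∃ b : Bool, ∀ y, IsResolution x y → F.eval (stable y) = some b

/-- A formula is hazard-free if it has no hazard. -/
def IsHazardFree (F : Formula ι) : Prop :=
  ∀ x, ¬ F.HasHazardAt x

end Formula

/-- The least depth of a hazard-free formula computing `f` (`⊤` if there is none). -/
noncomputable def hazardFreeDepth {ι : Type} (f : (ι → Bool) → Bool) : ℕ∞ :=
  ⨅ F ∈ {F : Formula ι | F.Computes f ∧ F.IsHazardFree}, (F.depth : ℕ∞)

/-- The least depth of a monotone formula computing `f` (`⊤` if there is none). -/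
noncomputable def monotoneDepth {ι : Type} (f : (ι → Bool) → Bool) : ℕ∞ :=
  ⨅ F ∈ {F : Formula ι | F.Computes f ∧ F.IsMonotone}, (F.depth : ℕ∞)

/-- Block composition: the input is a matrix with rows indexed by `ι`, the inner function is
applied to every row. -/
def blockComp {ι κ : Type} (f : (ι → Bool) → Bool) (g : (κ → Bool) → Bool) :
    (ι × κ → Bool) → Bool :=
  fun X => f (fun i => g (fun j => X (i, j)))

/-- The multiplexer with `m` address bits (left summand) and `2 ^ m` data bits (right summand).
The data bits are indexed by the binary addresses themselves. -/
def mux (m : ℕ) : (Fin m ⊕ (Fin m → Bool) → Bool) → Bool :=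
  fun z => z (Sum.inr (fun i => z (Sum.inl i)))

open Classical in
/-- The set covering function: the input is the edge set `E` of a bipartite graph on two copies of
`Fin n`, and the value is `1` iff some `k` vertices of the first copy have among their neighbours
every vertex of the second copy. -/
noncomputable def setCovering (k n : ℕ) : (Fin n × Fin n → Bool) → Bool :=
  fun E => decide (∃ S : Finset (Fin n), S.card = k ∧ ∀ v, ∃ u ∈ S, E (u, v) = true)

end HazardFree

namespace HazardFree

/-! Lower bound. A hazard-free formula is stable wherever the extension of its function is, so it
separates ternary 1-inputs from ternary 0-inputs. A formula of depth d cuts their product into at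
most 2^d rectangles, each solved by one coordinate. A matrix constant wherever a given coordinate
solves the game therefore has rank at most 2^d (`rank_le_two_pow_depth`). The matrix used is the
Kronecker product of disjointness of k-sets and compatibility of ternary addresses. Both factors are
invertible (`isUnit_disjMatrix`, `isUnit_compatMatrix`), so the rank is C(n,k) 3^m. A conflict in an
address bit forces the entry 0. A conflict in a data bit forces compatible addresses, and a graph
`N` separating disjoint k-sets lets its row (u, v) decide disjointness
(`choose_mul_three_pow_le_two_pow_depth`).

Barrier. A hazard-derivative of the composition only asks for an address in each row, which costs m
+ O(log m) instead of log(3) m. The outer function adds log C(n,k) + O(log n). As log 3 > 1, the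
rank bound is larger once m is a large multiple of log n. -/

theorem kAnd_eq_true : ∀ a b : Ternary, kAnd a b = some true ↔ a = some true ∧ b = some true := by
  decide

theorem kAnd_eq_false :
    ∀ a b : Ternary, kAnd a b = some false ↔ a = some false ∨ b = some false := by
  decide

theorem kOr_eq_true : ∀ a b : Ternary, kOr a b = some true ↔ a = some true ∨ b = some true := by
  decide

theorem kOr_eq_false :
    ∀ a b : Ternary, kOr a b = some false ↔ a = some false ∧ b = some false := by
  decide

theorem kNot_eq_some : ∀ (a : Ternary) (b : Bool), kNot a = some b ↔ a = some (!b) := by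
  decide

/-! ### Kleene evaluation and existence of hazard-free formulas -/

namespace Formula

variable {ι : Type}

/-- Kleene evaluation is monotone in the information order. -/
theorem eval_stable_of_eval (F : Formula ι) {x : ι → Ternary} {y : ι → Bool}
    (h : IsResolution x y) {b : Bool} (hx : F.eval x = some b) : F.eval (stable y) = some b := by
  induction F generalizing b with
  | var i =>
    rcases h i with h | h <;> simp_all [eval, stable]
  | neg F ih =>
    simp only [eval, kNot_eq_some] at hx ⊢
    exact ih hx
  | and F G ihF ihG =>
    cases b
    · simp only [eval, kAnd_eq_false] at hx ⊢
      exact hx.imp ihF ihG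
    · simp only [eval, kAnd_eq_true] at hx ⊢
      exact hx.imp ihF ihG
  | or F G ihF ihG =>
    cases b
    · simp only [eval, kOr_eq_false] at hx ⊢
      exact hx.imp ihF ihG
    · simp only [eval, kOr_eq_true] at hx ⊢
      exact hx.imp ihF ihG

/-- A hazard-free formula agrees with the hazard-free extension of the function it computes. -/
theorem IsHazardFree.eval_eq {F : Formula ι} (hF : F.IsHazardFree) {f : (ι → Bool) → Bool}
    (hf : F.Computes f) {x : ι → Ternary} {b : Bool}
    (h : ∀ y, IsResolution x y → f y = b) : F.eval x = some b := by
  rcases hx : F.eval x with _ | b'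
  · exact (hF x ⟨hx, b, fun y hy => by rw [hf y, h y hy]⟩).elim
  · have hy : IsResolution x fun i => (x i).getD true := by
      intro i
      rcases hi : x i with _ | c <;> simp [hi]
    have h1 := F.eval_stable_of_eval hy hx
    rw [hf, h _ hy] at h1
    exact h1.symm

/-- Nonemptiness is needed because formulas have no constant leaves. Both truth values are recorded,
as in Kleene's logic neither determines the other. -/
theorem exists_conj {α : Type} {s : Finset α} (hs : s.Nonempty) (G : α → Formula ι) :
    ∃ F : Formula ι, ∀ x, (F.eval x = some true ↔ ∀ i ∈ s, (G i).eval x = some true) ∧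
      (F.eval x = some false ↔ ∃ i ∈ s, (G i).eval x = some false) := by
  induction hs using Finset.Nonempty.cons_induction with
  | singleton a => exact ⟨G a, by simp⟩
  | cons a s ha hs ih =>
    obtain ⟨F, hF⟩ := ih
    exact ⟨and (G a) F, fun x => by simp [eval, kAnd_eq_true, kAnd_eq_false, hF]⟩

theorem exists_disj {α : Type} {s : Finset α} (hs : s.Nonempty) (G : α → Formula ι) :
    ∃ F : Formula ι, ∀ x, (F.eval x = some true ↔ ∃ i ∈ s, (G i).eval x = some true) ∧
      (F.eval x = some false ↔ ∀ i ∈ s, (G i).eval x = some false) := by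
  induction hs using Finset.Nonempty.cons_induction with
  | singleton a => exact ⟨G a, by simp⟩
  | cons a s ha hs ih =>
    obtain ⟨F, hF⟩ := ih
    exact ⟨or (G a) F, fun x => by simp [eval, kOr_eq_true, kOr_eq_false, hF]⟩

theorem exists_literal (i : ι) (b : Bool) :
    ∃ F : Formula ι, ∀ (x : ι → Ternary) (c : Bool),
      F.eval x = some c ↔ x i = some (if b then c else !c) := by
  cases b
  · exact ⟨neg (var i), fun x c => by simp [eval, kNot_eq_some]⟩
  · exact ⟨var i, fun x c => by simp [eval]⟩

/-- The disjunction of all implicants of a nonconstant function is a hazard-free formula for it. -/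
theorem exists_isHazardFree [Finite ι] (f : (ι → Bool) → Bool) (h0 : ∃ y, f y = false)
    (h1 : ∃ y, f y = true) : ∃ F : Formula ι, F.Computes f ∧ F.IsHazardFree := by
  classical
  cases nonempty_fintype ι
  suffices h : ∃ F : Formula ι, ∀ x b, (∀ y, IsResolution x y → f y = b) → F.eval x = some b by
    obtain ⟨F, hF⟩ := h
    have hc : F.Computes f := by
      intro y
      refine hF _ _ fun z hz => ?_
      congr
      funext i
      have := hz i
      simp_all [stable]
    refine ⟨F, hc, ?_⟩
    rintro x ⟨hx, b, hb⟩
    have := hF x b fun y hy => by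
      have := hb y hy
      rw [hc y] at this
      exact Option.some_injective _ this
    simp_all
  choose lit hlit using @exists_literal ι
  have hterm : ∀ z : ι → Ternary, (∀ y, IsResolution z y → f y = true) →
      ∃ T : Formula ι, ∀ x, (T.eval x = some true ↔ ∀ i b, z i = some b → x i = some b) ∧
        (T.eval x = some false ↔ ∃ i b, z i = some b ∧ x i = some (!b)) := by
    intro z hz
    -- An implicant without stable coordinates would make `f` constantly true.
    have hne : (Finset.univ.filter fun q : ι × Bool => z q.1 = some q.2).Nonempty := by
      by_contra hcon
      rw [Finset.not_nonempty_iff_eq_empty, Finset.filter_eq_empty_iff] at hcon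
      obtain ⟨y, hy⟩ := h0
      have : IsResolution z y := by
        intro i
        rcases hzi : z i with _ | b
        · exact Or.inl rfl
        · exact (hcon (Finset.mem_univ (i, b)) hzi).elim
      simp [hz y this] at hy
    obtain ⟨T, hT⟩ := exists_conj hne fun q => lit q.1 q.2
    refine ⟨T, fun x => ⟨?_, ?_⟩⟩
    · rw [(hT x).1]
      simp [hlit]
    · rw [(hT x).2]
      simp [hlit]
  have : Nonempty (Formula ι) := by
    obtain ⟨y, hy⟩ := h0
    obtain ⟨z, hz⟩ := h1
    rcases isEmpty_or_nonempty ι with hι | ⟨⟨i⟩⟩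
    · rw [Subsingleton.elim y z, hz] at hy
      simp at hy
    · exact ⟨var i⟩
  choose! T hT using hterm
  have hne : (Finset.univ.filter
      fun z : ι → Ternary => ∀ y, IsResolution z y → f y = true).Nonempty := by
    obtain ⟨y, hy⟩ := h1
    refine ⟨stable y, ?_⟩
    simp only [Finset.mem_filter, Finset.mem_univ, true_and]
    intro z hz
    have : z = y := by
      funext i
      have := hz i
      simp_all [stable]
    rw [this, hy]
  obtain ⟨F, hF⟩ := exists_disj hne T
  refine ⟨F, fun x b hb => ?_⟩
  cases b
  · rw [(hF x).2]
    intro z hz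
    simp only [Finset.mem_filter, Finset.mem_univ, true_and] at hz
    rw [(hT z hz x).2]
    by_contra! hcon
    -- An implicant `z` that does not conflict with `x` shares a resolution with it, where `f` would
    -- be both true and false.
    have h3 : IsResolution z fun i => (z i).getD ((x i).getD true) := by
      intro i
      rcases hi : z i with _ | c <;> simp [hi]
    have h4 : IsResolution x fun i => (z i).getD ((x i).getD true) := by
      intro i
      rcases hzi : z i with _ | c
      · rcases hi : x i with _ | c <;> simp [hi, hzi]
      · have := hcon i c hzi
        rcases hxi : x i with _ | d
        · simp
        · simp only [hxi] at this
          cases c <;> cases d <;> simp_all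
    have := hz _ h3
    rw [hb _ h4] at this
    simp at this
  · rw [(hF x).1]
    -- Here `x` is itself an implicant.
    exact ⟨x, by simpa using hb, ((hT x hb x).1).2 fun i b h => h⟩

/-! ### The rank bound -/

theorem rank_add_le {R C : Type} [Fintype R] [Fintype C] (A B : Matrix R C ℚ) :
    (A + B).rank ≤ A.rank + B.rank := by
  rw [Matrix.rank, Matrix.rank, Matrix.rank, Matrix.mulVecLin_add]
  refine (Submodule.finrank_mono (LinearMap.range_add_le _ _)).trans ?_
  exact Submodule.finrank_add_le_finrank_add_finrank _ _

open Classical in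
/-- The entries of a matrix outside the rectangle `X × Y` are replaced by `0`. -/
noncomputable def mask {R C : Type} (M : Matrix R C ℚ) (X : Set R) (Y : Set C) : Matrix R C ℚ :=
  Matrix.of fun r c => if r ∈ X ∧ c ∈ Y then M r c else 0

theorem rank_mask_le_left {R C : Type} [Fintype R] [Fintype C] (M : Matrix R C ℚ) (X X' : Set R)
    (Y : Set C) (h : X' ⊆ X) :
    (mask M X Y).rank ≤ (mask M X' Y).rank + (mask M (X \ X') Y).rank := by
  have : mask M X Y = mask M X' Y + mask M (X \ X') Y := by
    ext r c
    have := @h r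
    simp only [mask, Matrix.of_apply, Matrix.add_apply, Set.mem_sdiff]
    by_cases h1 : r ∈ X <;> by_cases h2 : r ∈ X' <;> by_cases h3 : c ∈ Y <;> simp_all
  rw [this]
  exact rank_add_le _ _

theorem rank_mask_le_right {R C : Type} [Fintype R] [Fintype C] (M : Matrix R C ℚ) (X : Set R)
    (Y Y' : Set C) (h : Y' ⊆ Y) :
    (mask M X Y).rank ≤ (mask M X Y').rank + (mask M X (Y \ Y')).rank := by
  have : mask M X Y = mask M X Y' + mask M X (Y \ Y') := by
    ext r c
    have := @h c
    simp only [mask, Matrix.of_apply, Matrix.add_apply, Set.mem_sdiff]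
    by_cases h1 : c ∈ Y <;> by_cases h2 : c ∈ Y' <;> by_cases h3 : r ∈ X <;> simp_all
  rw [this]
  exact rank_add_le _ _

/-- Razborov's rank bound for the hazard-free Karchmer-Wigderson game: if the matrix `M` is
constant on every rectangle that can be solved by naming a single coordinate, then its rank on a
rectangle that is separated by `F` is at most `2 ^ F.depth`. -/
theorem rank_mask_le_two_pow_depth {R C : Type} [Fintype R] [Fintype C] (M : Matrix R C ℚ)
    (x : R → ι → Ternary) (y : C → ι → Ternary)
    (h : ∀ e b, ∃ q, ∀ r c, x r e = some b → y c e = some (!b) → M r c = q)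
    (F : Formula ι) (b : Bool) (X : Set R) (Y : Set C)
    (hX : ∀ r ∈ X, F.eval (x r) = some b) (hY : ∀ c ∈ Y, F.eval (y c) = some (!b)) :
    (mask M X Y).rank ≤ 2 ^ F.depth := by
  classical
  induction F generalizing b X Y with
  | var e =>
    obtain ⟨q, hq⟩ := h e b
    -- All entries of the rectangle equal `q`, so the rank is at most one.
    have : mask M X Y =
        Matrix.vecMulVec (fun r => if r ∈ X then q else 0) (fun c => if c ∈ Y then 1 else 0) := by
      ext r c
      simp only [mask, Matrix.of_apply, Matrix.vecMulVec_apply]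
      by_cases h1 : r ∈ X <;> by_cases h2 : c ∈ Y <;> simp [h1, h2]
      exact hq r c (hX r h1) (hY c h2)
    rw [this]
    simpa [depth] using Matrix.rank_vecMulVec_le _ _
  | neg F ih =>
    exact ih (!b) X Y (fun r hr => by simpa [eval, kNot_eq_some] using hX r hr)
      (fun c hc => by simpa [eval, kNot_eq_some] using hY c hc)
  | and F G ihF ihG =>
    have hpow : 2 ^ F.depth + 2 ^ G.depth ≤ 2 ^ (and F G).depth := by
      have h1 : 2 ^ F.depth ≤ 2 ^ max F.depth G.depth := Nat.pow_le_pow_right (by simp) (by simp)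
      have h2 : 2 ^ G.depth ≤ 2 ^ max F.depth G.depth := Nat.pow_le_pow_right (by simp) (by simp)
      simp only [depth, pow_succ]
      omega
    cases b
    · simp only [eval, kAnd_eq_true, kAnd_eq_false, Bool.not_false] at hX hY
      -- If the conjunction is false on a row, one of its inputs is: split the rows by whether `F`
      -- is false. When the columns carry the false value, they are split instead.
      refine (rank_mask_le_left M X {r ∈ X | F.eval (x r) = some false} Y (by grind)).trans
        ((add_le_add (ihF false _ _ ?_ ?_) (ihG false _ _ ?_ ?_)).trans hpow) <;>
        grind
    · simp only [eval, kAnd_eq_true, kAnd_eq_false, Bool.not_true] at hX hY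
      refine (rank_mask_le_right M X Y {c ∈ Y | F.eval (y c) = some false} (by grind)).trans
        ((add_le_add (ihF true _ _ ?_ ?_) (ihG true _ _ ?_ ?_)).trans hpow) <;>
        grind
  | or F G ihF ihG =>
    have hpow : 2 ^ F.depth + 2 ^ G.depth ≤ 2 ^ (or F G).depth := by
      have h1 : 2 ^ F.depth ≤ 2 ^ max F.depth G.depth := Nat.pow_le_pow_right (by simp) (by simp)
      have h2 : 2 ^ G.depth ≤ 2 ^ max F.depth G.depth := Nat.pow_le_pow_right (by simp) (by simp)
      simp only [depth, pow_succ]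
      omega
    cases b
    · simp only [eval, kOr_eq_true, kOr_eq_false, Bool.not_false] at hX hY
      refine (rank_mask_le_right M X Y {c ∈ Y | F.eval (y c) = some true} (by grind)).trans
        ((add_le_add (ihF false _ _ ?_ ?_) (ihG false _ _ ?_ ?_)).trans hpow) <;>
        grind
    · simp only [eval, kOr_eq_true, kOr_eq_false, Bool.not_true] at hX hY
      refine (rank_mask_le_left M X {r ∈ X | F.eval (x r) = some true} Y (by grind)).trans
        ((add_le_add (ihF true _ _ ?_ ?_) (ihG true _ _ ?_ ?_)).trans hpow) <;>
        grind

theorem rank_le_two_pow_depth {R C : Type} [Fintype R] [Fintype C] (M : Matrix R C ℚ)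
    (x : R → ι → Ternary) (y : C → ι → Ternary)
    (h : ∀ e b, ∃ q, ∀ r c, x r e = some b → y c e = some (!b) → M r c = q)
    (F : Formula ι) (hx : ∀ r, F.eval (x r) = some true) (hy : ∀ c, F.eval (y c) = some false) :
    M.rank ≤ 2 ^ F.depth := by
  have := rank_mask_le_two_pow_depth M x y h F true Set.univ Set.univ (fun r _ => hx r)
    (fun c _ => hy c)
  have h2 : mask M Set.univ Set.univ = M := by
    ext r c
    simp [mask]
  rwa [h2] at this

end Formula

/-- The least value of a natural valued function over a nonempty set is attained. -/
theorem exists_iInf_natCast_eq {α : Type} (s : Set α) (hs : s.Nonempty) (g : α → ℕ) :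
    ∃ a ∈ s, ⨅ b ∈ s, (g b : ℕ∞) = g a := by
  rw [← sInf_image]
  obtain ⟨a, ha, h⟩ := csInf_mem (hs.image fun b => (g b : ℕ∞))
  exact ⟨a, ha, h.symm⟩

/-! ### Invertibility of the disjointness matrix -/

/-- The disjointness matrix of the `k`-subsets of `Fin n`. -/
def disjMatrix (n k : ℕ) :
    Matrix {A : Finset (Fin n) // A.card = k} {A : Finset (Fin n) // A.card = k} ℚ :=
  Matrix.of fun A B => if Disjoint A.1 B.1 then 1 else 0

/-- What matters is that the count does not depend on `A`. -/
theorem card_superset_disjoint {n k : ℕ} (T A : Finset (Fin n)) (hT : T.card ≤ k)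
    (hA : A.card = k) (hTA : Disjoint T A) :
    (Finset.univ.filter fun B : Finset (Fin n) => B.card = k ∧ T ⊆ B ∧ Disjoint B A).card =
      (n - T.card - k).choose (k - T.card) := by
  have h : (Finset.univ.filter fun B : Finset (Fin n) => B.card = k ∧ T ⊆ B ∧ Disjoint B A) =
      ((Tᶜ \ A).powersetCard (k - T.card)).image (T ∪ ·) := by
    ext B
    simp only [Finset.mem_filter, Finset.mem_univ, true_and, Finset.mem_image,
      Finset.mem_powersetCard]
    constructor
    · rintro ⟨h1, h2, h3⟩
      refine ⟨B \ T, ⟨?_, ?_⟩, ?_⟩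
      · intro z hz
        rw [Finset.mem_sdiff] at hz
        simpa [hz.2] using Finset.disjoint_left.1 h3 hz.1
      · rw [Finset.card_sdiff_of_subset h2, h1]
      · exact Finset.union_sdiff_of_subset h2
    · rintro ⟨D, ⟨h1, h2⟩, rfl⟩
      have hd : Disjoint T D := by
        rw [Finset.disjoint_left]
        intro z hz hz'
        have := h1 hz'
        simp_all
      refine ⟨?_, Finset.subset_union_left, ?_⟩
      · rw [Finset.card_union_of_disjoint hd, h2]
        omega
      · rw [Finset.disjoint_union_left]
        refine ⟨hTA, ?_⟩
        rw [Finset.disjoint_left]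
        intro z hz
        have := h1 hz
        simp_all
  rw [h, Finset.card_image_of_injOn, Finset.card_powersetCard]
  · congr 1
    rw [Finset.card_sdiff_of_subset, Finset.card_compl, hA, Fintype.card_fin]
    intro z hz
    have := Finset.disjoint_right.1 hTA hz
    simpa using this
  · intro D hD D' hD' hDD
    have key : ∀ D ∈ ((Tᶜ \ A).powersetCard (k - T.card)), (T ∪ D) \ T = D := by
      intro D hD
      rw [Finset.union_sdiff_cancel_left]
      rw [Finset.disjoint_left]
      intro z hz hz'
      have := (Finset.mem_powersetCard.1 hD).1 hz'
      simp_all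
    rw [← key D hD, ← key D' hD']
    exact congrArg (· \ T) hDD

/-- Gottlieb's theorem for the disjointness matrix. -/
theorem isUnit_disjMatrix {n k : ℕ} (h : 2 * k ≤ n) : IsUnit (disjMatrix n k) := by
  classical
  rw [← Matrix.mulVec_injective_iff_isUnit, ← Matrix.coe_mulVecLin,
    injective_iff_map_eq_zero]
  intro f hf
  have hk : ∀ T : Finset (Fin n), T.card = k →
      ∑ A : {A : Finset (Fin n) // A.card = k}, (if Disjoint T A.1 then f A else 0) = 0 := by
    intro T hT
    have := congrFun hf ⟨T, hT⟩
    simpa [disjMatrix, Matrix.mulVec, dotProduct] using this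
  have hle : ∀ T : Finset (Fin n), T.card ≤ k →
      ∑ A : {A : Finset (Fin n) // A.card = k}, (if Disjoint T A.1 then f A else 0) = 0 := by
    intro T hT
    -- Sum the kernel equations over all k-sets `B` containing `T`: each `A` disjoint from `T` is
    -- counted equally often, and `2 * k ≤ n` makes this number positive.
    have h1 : ∑ B ∈ Finset.univ.filter (fun B : Finset (Fin n) => B.card = k ∧ T ⊆ B),
        ∑ A : {A : Finset (Fin n) // A.card = k}, (if Disjoint B A.1 then f A else 0) = 0 := by
      refine Finset.sum_eq_zero fun B hB => hk B ?_
      simp_all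
    rw [Finset.sum_comm] at h1
    have h2 : ∀ A : {A : Finset (Fin n) // A.card = k},
        ∑ B ∈ Finset.univ.filter (fun B : Finset (Fin n) => B.card = k ∧ T ⊆ B),
          (if Disjoint B A.1 then f A else 0) =
        ((n - T.card - k).choose (k - T.card) : ℚ) * (if Disjoint T A.1 then f A else 0) := by
      intro A
      rw [← Finset.sum_filter, Finset.sum_const, Finset.filter_filter, nsmul_eq_mul]
      split_ifs with hTA
      · rw [← card_superset_disjoint T A.1 hT A.2 hTA]
        simp only [and_assoc]
      · rw [Finset.filter_false_of_mem]
        · simp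
        · rintro B - ⟨⟨-, hB⟩, hB'⟩
          exact hTA (Finset.disjoint_of_subset_left hB hB')
    simp only [h2] at h1
    rw [← Finset.mul_sum] at h1
    refine (mul_eq_zero.1 h1).resolve_left ?_
    have : 0 < (n - T.card - k).choose (k - T.card) := Nat.choose_pos (by omega)
    exact_mod_cast this.ne'
  funext A₀
  -- Inclusion-exclusion over the subsets of `A₀`: the coefficient of `f A` is the alternating sum
  -- over subsets of `A₀ \ A`, which vanishes unless `A = A₀`.
  have h3 : ∑ T ∈ A₀.1.powerset, (-1 : ℚ) ^ T.card *
      ∑ A : {A : Finset (Fin n) // A.card = k}, (if Disjoint T A.1 then f A else 0) = 0 := by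
    refine Finset.sum_eq_zero fun T hT => ?_
    rw [hle T ((Finset.card_le_card (Finset.mem_powerset.1 hT)).trans A₀.2.le), mul_zero]
  simp only [Finset.mul_sum] at h3
  rw [Finset.sum_comm] at h3
  have h4 : ∀ A : {A : Finset (Fin n) // A.card = k},
      ∑ T ∈ A₀.1.powerset, (-1 : ℚ) ^ T.card * (if Disjoint T A.1 then f A else 0) =
        if A = A₀ then f A else 0 := by
    intro A
    have h5 : ∑ T ∈ A₀.1.powerset, (-1 : ℚ) ^ T.card * (if Disjoint T A.1 then f A else 0) =
        (∑ T ∈ (A₀.1 \ A.1).powerset, (-1 : ℚ) ^ T.card) * f A := by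
      have : (A₀.1 \ A.1).powerset = A₀.1.powerset.filter fun T => Disjoint T A.1 := by
        ext T
        simp [Finset.subset_sdiff]
      rw [this, Finset.sum_filter, Finset.sum_mul]
      refine Finset.sum_congr rfl fun T _ => ?_
      split_ifs <;> simp
    have h6 := congrArg (Int.cast : ℤ → ℚ)
      (Finset.sum_powerset_neg_one_pow_card (x := A₀.1 \ A.1))
    push_cast at h6
    rw [h5, h6]
    have h7 : A₀.1 ⊆ A.1 ↔ A = A₀ := by
      constructor
      · intro hs
        exact (Subtype.ext (Finset.eq_of_subset_of_card_le hs (by rw [A.2, A₀.2]))).symm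
      · rintro rfl
        exact subset_rfl
    simp only [Finset.sdiff_eq_empty_iff_subset, h7]
    split_ifs <;> simp
  simp only [h4] at h3
  simpa using h3

/-! ### Invertibility of the compatibility matrix -/

/-- Two ternary digits are compatible if they have a common resolution. -/
def compat : Ternary → Ternary → ℚ
  | some a, some b => if a = b then 1 else 0
  | _, _ => 1

/-- The entries of the inverse of the compatibility matrix. -/
def compatInv : Ternary → Ternary → ℚ
  | some a, some b => if a = b then 0 else -1
  | none, none => -1
  | _, _ => 1

/-- The matrix that says which pairs of ternary strings have a common resolution. -/
def compatMatrix (m : ℕ) : Matrix (Fin m → Ternary) (Fin m → Ternary) ℚ :=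
  Matrix.of fun s t => ∏ i, compat (s i) (t i)

theorem sum_compat_mul_compatInv (a c : Ternary) :
    ∑ b, compat a b * compatInv b c = if a = c then 1 else 0 := by
  rcases a with _ | _ | _ <;> rcases c with _ | _ | _ <;>
    norm_num [Fintype.sum_option, compat, compatInv] <;> exact nofun

/-- The matrix is the m-th tensor power of an invertible 3 × 3 matrix, so products of entries of the
small inverse give its inverse. -/
theorem isUnit_compatMatrix (m : ℕ) : IsUnit (compatMatrix m) := by
  classical
  rw [Matrix.isUnit_iff_isUnit_det]
  refine Matrix.isUnit_det_of_right_inverse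
    (B := Matrix.of fun s t : Fin m → Ternary => ∏ i, compatInv (s i) (t i)) ?_
  ext s r
  simp only [Matrix.mul_apply, compatMatrix, Matrix.of_apply, ← Finset.prod_mul_distrib]
  rw [← Fintype.prod_sum fun i b => compat (s i) b * compatInv b (r i)]
  simp only [sum_compat_mul_compatInv, Matrix.one_apply]
  split_ifs with h
  · simp [h]
  · obtain ⟨i, hi⟩ := Function.ne_iff.1 h
    exact Finset.prod_eq_zero (Finset.mem_univ i) (by simp [hi])

open scoped Kronecker in
theorem rank_kronecker_compatMatrix {n k : ℕ} (m : ℕ) (h : 2 * k ≤ n) :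
    (disjMatrix n k ⊗ₖ compatMatrix m).rank = n.choose k * 3 ^ m := by
  classical
  rw [Matrix.rank_of_isUnit]
  · simp [Fintype.card_prod]
  · have h1 := (Matrix.isUnit_iff_isUnit_det _).1 (isUnit_disjMatrix h)
    have h2 := (Matrix.isUnit_iff_isUnit_det _).1 (isUnit_compatMatrix m)
    rw [Matrix.isUnit_iff_isUnit_det, Matrix.det_kronecker]
    exact (h1.pow _).mul (h2.pow _)

/-! ### The separating graph -/

/-- Greedy covering. -/
theorem exists_greedy_cover {α τ : Type} [Fintype τ] [Nonempty τ] (P : Finset α)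
    (sep : τ → α → Prop) [∀ t a, Decidable (sep t a)] (q : ℝ)
    (hq : ∀ a, q * Fintype.card τ ≤ (Finset.univ.filter fun t => sep t a).card) (hq1 : q ≤ 1)
    (N : ℕ) : ∃ t : Fin N → τ,
      ((P.filter fun a => ∀ i, ¬ sep (t i) a).card : ℝ) ≤ (1 - q) ^ N * P.card := by
  induction N with
  | zero => exact ⟨Fin.elim0, by simp⟩
  | succ N ih =>
    obtain ⟨t, ht⟩ := ih
    set Q := P.filter fun a => ∀ i, ¬ sep (t i) a with hQ
    -- Double counting: on average a test separates a fraction of at least `q` of the remaining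
    -- elements.
    obtain ⟨t₀, -, ht₀⟩ : ∃ t₀ ∈ (Finset.univ : Finset τ),
        q * (Q.card : ℝ) ≤ ((Q.filter fun a => sep t₀ a).card : ℝ) := by
      refine Finset.exists_le_of_sum_le Finset.univ_nonempty ?_
      have h1 : ∑ t : τ, ((Q.filter fun a => sep t a).card : ℝ) =
          ∑ a ∈ Q, ((Finset.univ.filter fun t => sep t a).card : ℝ) := by
        simp only [Finset.card_filter, Nat.cast_sum]
        rw [Finset.sum_comm]
      rw [h1]
      calc ∑ _t : τ, q * (Q.card : ℝ) = ∑ _a ∈ Q, q * Fintype.card τ := by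
            simp only [Finset.sum_const, nsmul_eq_mul, Finset.card_univ]
            ring
        _ ≤ _ := Finset.sum_le_sum fun a _ => hq a
    refine ⟨Fin.cons t₀ t, ?_⟩
    have h2 : (P.filter fun a => ∀ i, ¬ sep ((Fin.cons t₀ t : Fin (N + 1) → τ) i) a) =
        Q.filter fun a => ¬ sep t₀ a := by
      ext a
      simp [hQ, Fin.forall_fin_succ]
      tauto
    have h3 : ((Q.filter fun a => sep t₀ a).card : ℝ) + (Q.filter fun a => ¬ sep t₀ a).card =
        Q.card := by
      exact_mod_cast Finset.card_filter_add_card_filter_not (s := Q) fun a => sep t₀ a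
    rw [h2]
    calc ((Q.filter fun a => ¬ sep t₀ a).card : ℝ) ≤ (1 - q) * Q.card := by linarith
      _ ≤ (1 - q) * ((1 - q) ^ N * P.card) := by gcongr
      _ = _ := by ring

/-- A bipartite graph with the isolated neighbour condition. -/
theorem exists_isolated_neighbour {n k : ℕ} (hk : 2 * k ≤ n)
    (h : (1 - 1 / 4 ^ k : ℝ) ^ n * (n : ℝ) ^ (2 * k) < 1) :
    ∃ N : Fin n → Finset (Fin n), ∀ A B : Finset (Fin n), A.card = k → B.card = k →
      Disjoint A B → ∃ v, A ⊆ N v ∧ Disjoint B (N v) := by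
  classical
  let α := {p : Finset (Fin n) × Finset (Fin n) //
    p.1.card = k ∧ p.2.card = k ∧ Disjoint p.1 p.2}
  -- A fraction 4^(-k) of all sets `T` separates a given disjoint pair. There are at most n^(2k)
  -- pairs, so after n greedy choices fewer than one pair remains.
  obtain ⟨N, hN⟩ := exists_greedy_cover (α := α) (τ := Finset (Fin n)) Finset.univ
    (fun T p => p.1.1 ⊆ T ∧ Disjoint p.1.2 T) (1 / 4 ^ k) (by
      rintro ⟨⟨A, B⟩, hA, hB, hAB⟩
      simp only at hA hB hAB
      have h1 : (Finset.univ.filter fun T => A ⊆ T ∧ Disjoint B T) = Finset.Icc A Bᶜ := by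
        ext T
        simp only [Finset.mem_filter, Finset.mem_univ, true_and, Finset.mem_Icc,
          Finset.subset_compl_iff_disjoint_left]
      have h2 : A ⊆ Bᶜ := by
        rwa [Finset.subset_compl_iff_disjoint_right]
      simp only [h1]
      rw [Finset.card_Icc_finset h2, Finset.card_compl, hA, hB, Fintype.card_finset,
        Fintype.card_fin]
      have h3 : (2 : ℝ) ^ n = 2 ^ (n - k - k) * 4 ^ k := by
        rw [show (4 : ℝ) = 2 ^ 2 by norm_num, ← pow_mul, ← pow_add]
        congr 1
        omega
      push_cast
      rw [h3]
      field_simp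
      exact le_refl _) (by
        rw [div_le_one (by positivity)]
        exact one_le_pow₀ (by norm_num)) n
  have hcard : ((Finset.univ : Finset α).card : ℝ) ≤ (n : ℝ) ^ (2 * k) := by
    have h1 : Fintype.card α ≤ Fintype.card
        ({A : Finset (Fin n) // A.card = k} × {A : Finset (Fin n) // A.card = k}) := by
      refine Fintype.card_le_of_injective
        (fun p => (⟨p.1.1, p.2.1⟩, ⟨p.1.2, p.2.2.1⟩)) ?_
      rintro ⟨⟨A, B⟩, _⟩ ⟨⟨A', B'⟩, _⟩ h
      simp_all
    rw [Fintype.card_prod, Fintype.card_finset_len, Fintype.card_fin] at h1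
    have h2 := Nat.choose_le_pow n k
    have h3 : Fintype.card α ≤ n ^ (2 * k) := by
      calc _ ≤ n.choose k * n.choose k := h1
        _ ≤ n ^ k * n ^ k := Nat.mul_le_mul h2 h2
        _ = _ := by rw [← pow_add, two_mul]
    rw [Finset.card_univ]
    exact_mod_cast h3
  refine ⟨N, fun A B hA hB hAB => ?_⟩
  by_contra! hcon
  have h1 : (1 : ℝ) ≤ ((Finset.univ.filter fun p : α =>
      ∀ i, ¬ (p.1.1 ⊆ N i ∧ Disjoint p.1.2 (N i))).card : ℝ) := by
    have : 0 < (Finset.univ.filter fun p : α =>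
        ∀ i, ¬ (p.1.1 ⊆ N i ∧ Disjoint p.1.2 (N i))).card := by
      refine Finset.card_pos.2 ⟨⟨(A, B), hA, hB, hAB⟩, ?_⟩
      simpa using hcon
    exact_mod_cast this
  have h2 : (0 : ℝ) ≤ 1 - 1 / 4 ^ k := by
    rw [sub_nonneg, div_le_one (by positivity)]
    exact one_le_pow₀ (by norm_num)
  have := mul_le_mul_of_nonneg_left hcard (pow_nonneg h2 n)
  linarith

/-! ### Hard inputs and the hazard-free lower bound -/

theorem setCovering_eq_true {k n : ℕ} {E : Fin n × Fin n → Bool} :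
    setCovering k n E = true ↔
      ∃ S : Finset (Fin n), S.card = k ∧ ∀ v, ∃ u ∈ S, E (u, v) = true := by
  simp [setCovering]

theorem setCovering_eq_false {k n : ℕ} {E : Fin n × Fin n → Bool} :
    setCovering k n E = false ↔
      ∀ S : Finset (Fin n), S.card = k → ∃ v, ∀ u ∈ S, E (u, v) = false := by
  simp [setCovering]

/-- The ternary input all of whose rows have address `s`, and whose row `r` has the data bit `b` on
the subcube of `s` if `r ∈ W`, and no other stable data bit. -/
noncomputable def cubeInput {ρ : Type} {m : ℕ} (s : Fin m → Ternary) (b : Bool) (W : ρ → Prop) :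
    ρ × (Fin m ⊕ (Fin m → Bool)) → Ternary :=
  open Classical in fun e => match e.2 with
    | Sum.inl i => s i
    | Sum.inr p => if IsResolution s p ∧ W e.1 then some b else none

/-- Whatever address the row resolves to lies in the subcube of `s`, where all data bits are `b`. -/
theorem mux_of_isResolution_cubeInput {ρ : Type} {m : ℕ} {s : Fin m → Ternary} {b : Bool}
    {W : ρ → Prop} {X : ρ × (Fin m ⊕ (Fin m → Bool)) → Bool}
    (h : IsResolution (cubeInput s b W) X) {r : ρ} (hr : W r) : mux m (fun j => X (r, j)) = b := by
  have h1 : IsResolution s fun i => X (r, Sum.inl i) := fun i => h (r, Sum.inl i)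
  have h2 := h (r, Sum.inr fun i => X (r, Sum.inl i))
  simp only [cubeInput, h1, hr, and_self, if_true] at h2
  simpa [mux, eq_comm] using h2

theorem compatMatrix_eq_zero {m : ℕ} {s t : Fin m → Ternary} {i : Fin m} {b : Bool}
    (hs : s i = some b) (ht : t i = some (!b)) : compatMatrix m s t = 0 := by
  refine Finset.prod_eq_zero (Finset.mem_univ i) ?_
  rw [hs, ht]
  cases b <;> simp [compat]

theorem compatMatrix_eq_one {m : ℕ} {s t : Fin m → Ternary} {p : Fin m → Bool}
    (hs : IsResolution s p) (ht : IsResolution t p) : compatMatrix m s t = 1 := by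
  rw [compatMatrix, Matrix.of_apply]
  refine Finset.prod_eq_one fun i _ => ?_
  rcases hs i with h | h <;> rcases ht i with h' | h' <;> rw [h, h'] <;> simp [compat]

open scoped Kronecker in
/-- Lower bound for hazard-free formulas for the composition of the set covering function with the
multiplexer. -/
theorem choose_mul_three_pow_le_two_pow_depth {n k m : ℕ} (hk : 1 ≤ k) (hkn : 2 * k ≤ n)
    (N : Fin n → Finset (Fin n))
    (hN : ∀ A B : Finset (Fin n), A.card = k → B.card = k → Disjoint A B →
      ∃ v, A ⊆ N v ∧ Disjoint B (N v))
    (F : Formula ((Fin n × Fin n) × (Fin m ⊕ (Fin m → Bool))))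
    (hF : F.Computes (blockComp (setCovering k n) (mux m))) (hF' : F.IsHazardFree) :
    n.choose k * 3 ^ m ≤ 2 ^ F.depth := by
  classical
  rw [← rank_kronecker_compatMatrix m hkn]
  refine Formula.rank_le_two_pow_depth _
    (fun a => cubeInput a.2 true
      fun r : Fin n × Fin n => r.1 ∈ a.1.1 ∧ (r.1 ∈ N r.2 → a.1.1 ⊆ N r.2))
    (fun a => cubeInput a.2 false
      fun r : Fin n × Fin n => if r.1 ∈ N r.2 then Disjoint a.1.1 (N r.2) else r.1 ∈ a.1.1)
    ?_ F ?_ ?_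
  · rintro ⟨⟨u, v⟩, i | p⟩ b
    · refine ⟨0, fun a a' h1 h2 => ?_⟩
      simp only [cubeInput] at h1 h2
      rw [Matrix.kronecker_apply, compatMatrix_eq_zero h1 h2, mul_zero]
    -- If `u ∈ N v`, both inputs are stable here only when `N v` contains `A` and avoids `B`, so the
    -- sets are disjoint. Otherwise `u` lies in both.
    · refine ⟨if u ∈ N v then 1 else 0, fun a a' h1 h2 => ?_⟩
      simp only [cubeInput, Option.ite_none_right_eq_some, Option.some.injEq] at h1 h2
      obtain ⟨⟨h3, h4, h5⟩, -⟩ := h1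
      obtain ⟨⟨h6, h7⟩, -⟩ := h2
      rw [Matrix.kronecker_apply, compatMatrix_eq_one h3 h6, mul_one]
      by_cases hu : u ∈ N v
      · rw [if_pos hu] at h7
        have : Disjoint a.1.1 a'.1.1 := (Finset.disjoint_of_subset_right (h5 hu) h7).symm
        simp [disjMatrix, this, hu]
      · rw [if_neg hu] at h7
        have : ¬ Disjoint a.1.1 a'.1.1 := Finset.not_disjoint_iff.2 ⟨u, h4, h7⟩
        simp [disjMatrix, this, hu]
  · rintro ⟨⟨A, hA⟩, s⟩
    refine hF'.eval_eq hF fun X hX => setCovering_eq_true.2 ⟨A, hA, fun v => ?_⟩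
    have hne : A.Nonempty := Finset.card_pos.1 (by omega)
    by_cases hAN : A ⊆ N v
    · obtain ⟨u, hu⟩ := hne
      exact ⟨u, hu, mux_of_isResolution_cubeInput hX ⟨hu, fun _ => hAN⟩⟩
    · obtain ⟨u, hu, hu'⟩ := Finset.not_subset.1 hAN
      exact ⟨u, hu, mux_of_isResolution_cubeInput hX ⟨hu, fun h => (hu' h).elim⟩⟩
  · rintro ⟨⟨B, hB⟩, t⟩
    refine hF'.eval_eq hF fun X hX => setCovering_eq_false.2 fun S hS => ?_
    -- Enlarge `S \ B` to a k-set avoiding `B`. At the vertex `v` separating the two, an element of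
    -- `S` outside `N v` must lie in `B`, so all rows of `S` at `v` are 0.
    obtain ⟨A, hSA, hAB, hA⟩ := Finset.exists_subsuperset_card_eq (s := S \ B) (t := Bᶜ) (n := k)
      (fun z hz => by simp_all) (hS ▸ Finset.card_le_card Finset.sdiff_subset) (by
        rw [Finset.card_compl, hB, Fintype.card_fin]
        omega)
    obtain ⟨v, hv, hv'⟩ := hN A B hA hB (Finset.subset_compl_iff_disjoint_right.1 hAB)
    refine ⟨v, fun u hu => mux_of_isResolution_cubeInput hX ?_⟩
    by_cases huN : u ∈ N v
    · rwa [if_pos huN]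
    · rw [if_neg huN]
      by_contra hcon
      exact huN (hv (hSA (Finset.mem_sdiff.2 ⟨hu, hcon⟩)))

/-! ### Depth calculus for monotone formulas -/

variable {ι : Type}

/-- The predicate is constant or decided by a monotone formula of depth at most `d`. -/
def MonotoneDepthLE (P : (ι → Bool) → Prop) (d : ℕ) : Prop :=
  (∀ y, P y) ∨ (∀ y, ¬ P y) ∨
    ∃ F : Formula ι, F.IsMonotone ∧ F.depth ≤ d ∧
      ∀ y, (F.eval (stable y) = some true ↔ P y) ∧ (F.eval (stable y) = some false ↔ ¬ P y)

namespace MonotoneDepthLE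

theorem const (p : Prop) (d : ℕ) : MonotoneDepthLE (fun _ : ι → Bool => p) d := by
  by_cases hp : p
  · exact Or.inl fun _ => hp
  · exact Or.inr (Or.inl fun _ => hp)

theorem var (i : ι) (d : ℕ) : MonotoneDepthLE (fun y : ι → Bool => y i = true) d :=
  Or.inr (Or.inr ⟨Formula.var i, trivial, by simp [Formula.depth], fun y => by
    simp [Formula.eval, stable]⟩)

theorem mono {P : (ι → Bool) → Prop} {d d' : ℕ} (h : MonotoneDepthLE P d) (hd : d ≤ d') :
    MonotoneDepthLE P d' :=
  h.imp_right (Or.imp_right fun ⟨F, h1, h2, h3⟩ => ⟨F, h1, h2.trans hd, h3⟩)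

theorem const_or_var (p : Prop) (i : ι) (d : ℕ) :
    MonotoneDepthLE (fun y : ι → Bool => p ∨ y i = true) d := by
  by_cases hp : p
  · simpa [hp] using const True d
  · simpa [hp] using var i d

theorem imp_var (p : Prop) (i : ι) (d : ℕ) :
    MonotoneDepthLE (fun y : ι → Bool => p → y i = true) d := by
  simpa only [imp_iff_not_or] using const_or_var (¬ p) i d

/-- A constant operand either disappears or absorbs the gate, which is why constants can be carried
along as separate cases. -/
theorem and {P Q : (ι → Bool) → Prop} {d : ℕ} (hP : MonotoneDepthLE P d)
    (hQ : MonotoneDepthLE Q d) : MonotoneDepthLE (fun y => P y ∧ Q y) (d + 1) := by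
  rcases hP with hP | hP | ⟨F, h1, h2, h3⟩
  · simpa [hP] using hQ.mono (Nat.le_succ d)
  · simpa [hP] using const False (d + 1)
  rcases hQ with hQ | hQ | ⟨G, h4, h5, h6⟩
  · simpa [hQ] using mono (Or.inr (Or.inr ⟨F, h1, h2, h3⟩)) (Nat.le_succ d)
  · simpa [hQ] using const False (d + 1)
  refine Or.inr (Or.inr ⟨F.and G, ⟨h1, h4⟩, by simp [Formula.depth, h2, h5], fun y => ?_⟩)
  simp only [Formula.eval, kAnd_eq_true, kAnd_eq_false, h3, h6]
  tauto

theorem or {P Q : (ι → Bool) → Prop} {d : ℕ} (hP : MonotoneDepthLE P d)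
    (hQ : MonotoneDepthLE Q d) : MonotoneDepthLE (fun y => P y ∨ Q y) (d + 1) := by
  rcases hP with hP | hP | ⟨F, h1, h2, h3⟩
  · simpa [hP] using const True (d + 1)
  · simpa [hP] using hQ.mono (Nat.le_succ d)
  rcases hQ with hQ | hQ | ⟨G, h4, h5, h6⟩
  · simpa [hQ] using const True (d + 1)
  · simpa [hQ] using mono (Or.inr (Or.inr ⟨F, h1, h2, h3⟩)) (Nat.le_succ d)
  refine Or.inr (Or.inr ⟨F.or G, ⟨h1, h4⟩, by simp [Formula.depth, h2, h5], fun y => ?_⟩)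
  simp only [Formula.eval, kOr_eq_true, kOr_eq_false, h3, h6]
  tauto

/-- A balanced binary tree: halve the index set `e` times. -/
theorem forall_mem {α : Type} {P : α → (ι → Bool) → Prop} {d e : ℕ} {s : Finset α}
    (hs : s.card ≤ 2 ^ e) (hP : ∀ a ∈ s, MonotoneDepthLE (P a) d) :
    MonotoneDepthLE (fun y => ∀ a ∈ s, P a y) (d + e) := by
  classical
  induction e generalizing s with
  | zero =>
    rcases Nat.le_one_iff_eq_zero_or_eq_one.1 (by simpa using hs) with h | h
    · rw [Finset.card_eq_zero.1 h]
      simpa using const True d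
    · obtain ⟨a, rfl⟩ := Finset.card_eq_one.1 h
      simpa using hP
  | succ e ih =>
    obtain ⟨t, hts, ht⟩ := Finset.exists_subset_card_eq (min_le_right (2 ^ e) s.card)
    have h1 := ih (s := t) (by omega) fun a ha => hP a (hts ha)
    have h2 := ih (s := s \ t) (by
      rw [Finset.card_sdiff_of_subset hts]
      rw [pow_succ] at hs
      omega) fun a ha => hP a (Finset.sdiff_subset ha)
    have h3 : (fun y => ∀ a ∈ s, P a y) =
        fun y => (∀ a ∈ t, P a y) ∧ ∀ a ∈ s \ t, P a y := by
      funext y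
      rw [← Finset.forall_mem_union, Finset.union_sdiff_of_subset hts]
    rw [h3]
    exact h1.and h2

theorem exists_mem {α : Type} {P : α → (ι → Bool) → Prop} {d e : ℕ} {s : Finset α}
    (hs : s.card ≤ 2 ^ e) (hP : ∀ a ∈ s, MonotoneDepthLE (P a) d) :
    MonotoneDepthLE (fun y => ∃ a ∈ s, P a y) (d + e) := by
  classical
  induction e generalizing s with
  | zero =>
    rcases Nat.le_one_iff_eq_zero_or_eq_one.1 (by simpa using hs) with h | h
    · rw [Finset.card_eq_zero.1 h]
      simpa using const False d
    · obtain ⟨a, rfl⟩ := Finset.card_eq_one.1 h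
      simpa using hP
  | succ e ih =>
    obtain ⟨t, hts, ht⟩ := Finset.exists_subset_card_eq (min_le_right (2 ^ e) s.card)
    have h1 := ih (s := t) (by omega) fun a ha => hP a (hts ha)
    have h2 := ih (s := s \ t) (by
      rw [Finset.card_sdiff_of_subset hts]
      rw [pow_succ] at hs
      omega) fun a ha => hP a (Finset.sdiff_subset ha)
    have h3 : (fun y => ∃ a ∈ s, P a y) =
        fun y => (∃ a ∈ t, P a y) ∨ ∃ a ∈ s \ t, P a y := by
      funext y
      conv_lhs => rw [← Finset.union_sdiff_of_subset hts]
      simp only [Finset.mem_union, or_and_right, exists_or]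
    rw [h3]
    exact h1.or h2

end MonotoneDepthLE

/-! ### Hazard-derivatives of the composition -/

theorem hazardDerivative_eq_true {f : (ι → Bool) → Bool} {x y : ι → Bool} :
    hazardDerivative f x y = true ↔ ∃ z, IsResolution (perturb x y) z ∧ f z ≠ f x := by
  have hx : IsResolution (perturb x y) x := by
    intro i
    by_cases h : y i = true <;> simp [perturb, h]
  rw [hazardDerivative, decide_eq_true_iff]
  constructor
  · intro h
    rw [extension] at h
    by_contra! hcon
    cases hb : f x
    · rw [if_pos fun z hz => by rw [hcon z hz, hb]] at h
      cases h
    · split_ifs at h with h1 h2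
      exact h2 fun z hz => by rw [hcon z hz, hb]
  · rintro ⟨z, hz, hne⟩
    rw [extension, if_neg, if_neg]
    · intro h
      exact hne (by rw [h z hz, h x hx])
    · intro h
      exact hne (by rw [h z hz, h x hx])

theorem isResolution_perturb {x y z : ι → Bool} :
    IsResolution (perturb x y) z ↔ ∀ i, z i ≠ x i → y i = true := by
  refine forall_congr' fun i => ?_
  by_cases h : y i = true
  · simp [perturb, h]
  · simp [perturb, h, eq_comm]

/-- The output can change iff some reachable address `p` has a data bit that already differs or may
be flipped. The index `none` carries this data condition, giving one conjunction of m + 1 terms. -/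
theorem hazardDerivative_mux {m : ℕ} {x y : Fin m ⊕ (Fin m → Bool) → Bool} :
    hazardDerivative (mux m) x y = true ↔ ∃ p ∈ (Finset.univ : Finset (Fin m → Bool)),
      ∀ j ∈ (Finset.univ : Finset (Option (Fin m))), j.elim
        (x (Sum.inr p) ≠ mux m x ∨ y (Sum.inr p) = true)
        (fun i => p i ≠ x (Sum.inl i) → y (Sum.inl i) = true) := by
  simp only [hazardDerivative_eq_true, isResolution_perturb, Finset.mem_univ, true_and,
    forall_const, Option.forall, Option.elim]
  constructor
  · rintro ⟨z, hz, hne⟩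
    refine ⟨fun i => z (Sum.inl i), ?_, fun i hi => hz _ hi⟩
    by_contra! hcon
    refine hcon.2 (hz _ ?_)
    rw [hcon.1]
    exact hne
  · rintro ⟨p, h1, h2⟩
    classical
    refine ⟨Sum.elim p (Function.update (fun q => x (Sum.inr q)) p (!mux m x)), ?_, ?_⟩
    · rintro (i | q) hi
      · exact h2 i hi
      · by_cases hq : q = p
        · subst hq
          simp only [Sum.elim_inr, Function.update_self] at hi
          rcases h1 with h1 | h1
          · exact (hi (by cases mux m x <;> simp_all)).elim
          · exact h1
        · simp [hq] at hi
    · conv_lhs => rw [mux]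
      simp

theorem monotoneDepthLE_hazardDerivative_mux {m : ℕ} (x : Fin m ⊕ (Fin m → Bool) → Bool)
    (φ : Fin m ⊕ (Fin m → Bool) → ι) :
    MonotoneDepthLE (fun y : ι → Bool => hazardDerivative (mux m) x (y ∘ φ) = true)
      (Nat.clog 2 (m + 1) + m) := by
  simp only [hazardDerivative_mux]
  refine MonotoneDepthLE.exists_mem (by simp) fun p _ => ?_
  rw [← Nat.zero_add (Nat.clog 2 (m + 1))]
  refine MonotoneDepthLE.forall_mem
    (by simpa using Nat.le_pow_clog one_lt_two (m + 1)) ?_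
  rintro (_ | i) -
  · exact MonotoneDepthLE.const_or_var _ (φ (Sum.inr p)) 0
  · exact MonotoneDepthLE.imp_var _ (φ (Sum.inl i)) 0

/-- Chain rule for the hazard-derivative at a point where the outer function is `0`. -/
theorem hazardDerivative_setCovering_of_false {κ : Type} {k n : ℕ} {g : (κ → Bool) → Bool}
    {x y : (Fin n × Fin n) × κ → Bool} (hx : blockComp (setCovering k n) g x = false) :
    hazardDerivative (blockComp (setCovering k n) g) x y = true ↔
      ∃ S ∈ Finset.univ.powersetCard k, ∀ v ∈ (Finset.univ : Finset (Fin n)), ∃ u ∈ S,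
        g (fun j => x ((u, v), j)) = true ∨
          hazardDerivative g (fun j => x ((u, v), j)) (fun j => y ((u, v), j)) = true := by
  classical
  simp only [hazardDerivative_eq_true, isResolution_perturb, hx, ne_eq, Bool.not_eq_false,
    Finset.mem_powersetCard, Finset.subset_univ, true_and, Finset.mem_univ, forall_const]
  constructor
  · rintro ⟨z, hz, hzt⟩
    obtain ⟨S, hS, h⟩ := setCovering_eq_true.1 hzt
    refine ⟨S, hS, fun v => ?_⟩
    obtain ⟨u, hu, huv⟩ := h v
    refine ⟨u, hu, ?_⟩
    by_contra! hcon
    refine hcon.1 ?_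
    rw [← hcon.2 (fun j => z ((u, v), j)) (fun j hj => hz _ hj), huv]
  · rintro ⟨S, hS, h⟩
    -- Rows are perturbed independently and set covering is monotone, so every row that can be made
    -- 1 is made 1.
    have hrow : ∀ r : Fin n × Fin n, ∃ z : κ → Bool,
        (∀ j, z j ≠ x (r, j) → y (r, j) = true) ∧
        ((g (fun j => x (r, j)) = true ∨ ∃ z : κ → Bool,
          (∀ j, z j ≠ x (r, j) → y (r, j) = true) ∧ g z ≠ g fun j => x (r, j)) → g z = true) := by
      intro r
      by_cases h1 : g (fun j => x (r, j)) = true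
      · exact ⟨fun j => x (r, j), by simp, fun _ => h1⟩
      · by_cases h2 : ∃ z : κ → Bool,
          (∀ j, z j ≠ x (r, j) → y (r, j) = true) ∧ g z ≠ g fun j => x (r, j)
        · obtain ⟨z, hz, hne⟩ := h2
          exact ⟨z, hz, fun _ => by simp_all⟩
        · exact ⟨fun j => x (r, j), by simp, fun h3 => (h3.elim h1 h2).elim⟩
    choose z hz hz' using hrow
    refine ⟨fun e => z e.1 e.2, fun e he => hz e.1 e.2 he, setCovering_eq_true.2 ⟨S, hS, ?_⟩⟩
    intro v
    obtain ⟨u, hu, huv⟩ := h v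
    exact ⟨u, hu, hz' (u, v) huv⟩

/-- Chain rule for the hazard-derivative at a point where the outer function is `1`. -/
theorem hazardDerivative_setCovering_of_true {κ : Type} {k n : ℕ} {g : (κ → Bool) → Bool}
    {x y : (Fin n × Fin n) × κ → Bool} (hx : blockComp (setCovering k n) g x = true) :
    hazardDerivative (blockComp (setCovering k n) g) x y = true ↔
      ∀ S ∈ Finset.univ.powersetCard k, ∃ v ∈ (Finset.univ : Finset (Fin n)), ∀ u ∈ S,
        g (fun j => x ((u, v), j)) = false ∨
          hazardDerivative g (fun j => x ((u, v), j)) (fun j => y ((u, v), j)) = true := by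
  classical
  simp only [hazardDerivative_eq_true, isResolution_perturb, hx, ne_eq, Bool.not_eq_true,
    Finset.mem_powersetCard, Finset.subset_univ, true_and, Finset.mem_univ]
  constructor
  · rintro ⟨z, hz, hzt⟩ S hS
    obtain ⟨v, h⟩ := setCovering_eq_false.1 hzt S hS
    refine ⟨v, fun u hu => ?_⟩
    by_contra! hcon
    refine hcon.1 ?_
    rw [← hcon.2 (fun j => z ((u, v), j)) (fun j hj => hz _ hj)]
    exact h u hu
  · intro h
    -- Dually, every row that can be made 0 is made 0.
    have hrow : ∀ r : Fin n × Fin n, ∃ z : κ → Bool,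
        (∀ j, z j ≠ x (r, j) → y (r, j) = true) ∧
        ((g (fun j => x (r, j)) = false ∨ ∃ z : κ → Bool,
          (∀ j, z j ≠ x (r, j) → y (r, j) = true) ∧ g z ≠ g fun j => x (r, j)) → g z = false) := by
      intro r
      by_cases h1 : g (fun j => x (r, j)) = false
      · exact ⟨fun j => x (r, j), by simp, fun _ => h1⟩
      · by_cases h2 : ∃ z : κ → Bool,
          (∀ j, z j ≠ x (r, j) → y (r, j) = true) ∧ g z ≠ g fun j => x (r, j)
        · obtain ⟨z, hz, hne⟩ := h2
          exact ⟨z, hz, fun _ => by simp_all⟩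
        · exact ⟨fun j => x (r, j), by simp, fun h3 => (h3.elim h1 h2).elim⟩
    choose z hz hz' using hrow
    refine ⟨fun e => z e.1 e.2, fun e he => hz e.1 e.2 he, setCovering_eq_false.2 ?_⟩
    intro S hS
    obtain ⟨v, hv⟩ := h S hS
    exact ⟨v, fun u hu => hz' (u, v) (hv u hu)⟩

theorem monotoneDepthLE_hazardDerivative_setCovering_mux (k n m : ℕ)
    (x : (Fin n × Fin n) × (Fin m ⊕ (Fin m → Bool)) → Bool) :
    MonotoneDepthLE
      (fun y => hazardDerivative (blockComp (setCovering k n) (mux m)) x y = true)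
      (Nat.clog 2 (m + 1) + m + Nat.clog 2 k + Nat.clog 2 n + Nat.clog 2 (n.choose k)) := by
  have hrow : ∀ (p : Prop) (r : Fin n × Fin n),
      MonotoneDepthLE (fun y : (Fin n × Fin n) × (Fin m ⊕ (Fin m → Bool)) → Bool =>
        p ∨ hazardDerivative (mux m) (fun j => x (r, j)) (fun j => y (r, j)) = true)
        (Nat.clog 2 (m + 1) + m) := by
    intro p r
    by_cases hp : p
    · simpa [hp] using MonotoneDepthLE.const True _
    · simpa [hp, Function.comp_def] using
        monotoneDepthLE_hazardDerivative_mux (fun j => x (r, j)) fun j => (r, j)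
  have hS : (Finset.univ.powersetCard k : Finset (Finset (Fin n))).card ≤
      2 ^ Nat.clog 2 (n.choose k) := by
    simpa using Nat.le_pow_clog one_lt_two (n.choose k)
  have hV : (Finset.univ : Finset (Fin n)).card ≤ 2 ^ Nat.clog 2 n := by
    simpa using Nat.le_pow_clog one_lt_two n
  have hU : ∀ S ∈ (Finset.univ.powersetCard k : Finset (Finset (Fin n))),
      S.card ≤ 2 ^ Nat.clog 2 k := by
    intro S hS
    rw [(Finset.mem_powersetCard.1 hS).2]
    exact Nat.le_pow_clog one_lt_two k
  cases hx : blockComp (setCovering k n) (mux m) x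
  · simp only [hazardDerivative_setCovering_of_false hx]
    exact MonotoneDepthLE.exists_mem hS fun S hS' => MonotoneDepthLE.forall_mem hV fun v _ =>
      MonotoneDepthLE.exists_mem (hU S hS') fun u _ => hrow _ (u, v)
  · simp only [hazardDerivative_setCovering_of_true hx]
    exact MonotoneDepthLE.forall_mem hS fun S hS' => MonotoneDepthLE.exists_mem hV fun v _ =>
      MonotoneDepthLE.forall_mem (hU S hS') fun u _ => hrow _ (u, v)

theorem blockComp_setCovering_mux_const {k n m : ℕ} (hk : 1 ≤ k) (hkn : k ≤ n) (b : Bool) :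
    blockComp (setCovering k n) (mux m) (fun _ => b) = b := by
  cases b
  · refine setCovering_eq_false.2 fun S _ => ⟨⟨0, by omega⟩, fun u _ => rfl⟩
  · obtain ⟨S, -, hS⟩ := Finset.exists_subset_card_eq
      (s := (Finset.univ : Finset (Fin n))) (n := k) (by simpa using hkn)
    refine setCovering_eq_true.2 ⟨S, hS, fun v => ?_⟩
    obtain ⟨u, hu⟩ := Finset.card_pos.1 (show 0 < S.card by omega)
    exact ⟨u, hu, rfl⟩

/-- The derivative is 0 at the zero vector and 1 at the all-ones vector, since the composition is
not constant. This excludes the constant cases, for which no monotone formula exists. -/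
theorem exists_monotoneDepth_eq {k n m : ℕ} (hk : 1 ≤ k) (hkn : k ≤ n)
    (x : (Fin n × Fin n) × (Fin m ⊕ (Fin m → Bool)) → Bool) :
    ∃ d : ℕ, monotoneDepth (hazardDerivative (blockComp (setCovering k n) (mux m)) x) = (d : ℕ∞) ∧
      d ≤ Nat.clog 2 (m + 1) + m + Nat.clog 2 k + Nat.clog 2 n + Nat.clog 2 (n.choose k) := by
  obtain h | h | ⟨F, h1, h2, h3⟩ := monotoneDepthLE_hazardDerivative_setCovering_mux k n m x
  · obtain ⟨z, hz, hne⟩ := hazardDerivative_eq_true.1 (h fun _ => false)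
    have : z = x := by
      funext i
      by_contra hi
      simpa using isResolution_perturb.1 hz i hi
    exact (hne (by rw [this])).elim
  · refine (h (fun _ => true) (hazardDerivative_eq_true.2
      ⟨fun _ => !blockComp (setCovering k n) (mux m) x, by simp [isResolution_perturb], ?_⟩)).elim
    rw [blockComp_setCovering_mux_const hk hkn]
    simp
  · have hF : F ∈ {F : Formula _ | F.Computes
        (hazardDerivative (blockComp (setCovering k n) (mux m)) x) ∧ F.IsMonotone} := by
      refine ⟨fun y => ?_, h1⟩
      cases hy : hazardDerivative (blockComp (setCovering k n) (mux m)) x y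
      · exact (h3 y).2.2 (by simp [hy])
      · exact (h3 y).1.2 hy
    obtain ⟨G, hG, h⟩ := exists_iInf_natCast_eq _ ⟨F, hF⟩ Formula.depth
    refine ⟨G.depth, h, le_trans ?_ h2⟩
    have h4 : (G.depth : ℕ∞) ≤ F.depth := h ▸ iInf₂_le F hF
    exact_mod_cast h4

theorem exists_hazardFreeDepth_eq {k n m : ℕ} (hk : 1 ≤ k) (hkn : 2 * k ≤ n)
    (h : (1 - 1 / 4 ^ k : ℝ) ^ n * (n : ℝ) ^ (2 * k) < 1) :
    ∃ D : ℕ, hazardFreeDepth (blockComp (setCovering k n) (mux m)) = (D : ℕ∞) ∧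
      n.choose k * 3 ^ m ≤ 2 ^ D := by
  obtain ⟨N, hN⟩ := exists_isolated_neighbour hkn h
  obtain ⟨F, hF⟩ := Formula.exists_isHazardFree (blockComp (setCovering k n) (mux m))
    ⟨_, blockComp_setCovering_mux_const hk (by omega) false⟩
    ⟨_, blockComp_setCovering_mux_const hk (by omega) true⟩
  obtain ⟨G, hG, h⟩ := exists_iInf_natCast_eq
    {F : Formula _ | F.Computes (blockComp (setCovering k n) (mux m)) ∧ F.IsHazardFree}
    ⟨F, hF⟩ Formula.depth
  exact ⟨G.depth, h, choose_mul_three_pow_le_two_pow_depth hk hkn N hN G hG.1 hG.2⟩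

/-! ### Numerical estimates -/

theorem clog_two_le {x : ℕ} (hx : 1 ≤ x) : (Nat.clog 2 x : ℝ) ≤ Real.logb 2 x + 1 := by
  have h := Real.natCeil_logb_natCast 2 x
  have h1 : 0 ≤ Real.logb 2 (x : ℝ) := Real.logb_nonneg one_lt_two (by exact_mod_cast hx)
  rw [← h]
  push_cast
  exact (Nat.ceil_lt_add_one h1).le

/-- As 0.34 < (log 2)/2, the cubic term of the exponential series suffices; it exceeds L² from about
L = 153 on. -/
theorem sq_le_two_rpow_half {L : ℝ} (hL : 200 ≤ L) : L ^ 2 ≤ (2 : ℝ) ^ (L / 2) := by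
  have h1 := Real.log_two_gt_d9
  have h2 : (0.34 * L) ^ 3 / (Nat.factorial 3 : ℕ) ≤ Real.exp (0.34 * L) :=
    Real.pow_div_factorial_le_exp _ (by linarith) 3
  rw [Real.rpow_def_of_pos two_pos]
  have h3 : Real.exp (0.34 * L) ≤ Real.exp (Real.log 2 * (L / 2)) := by
    apply Real.exp_le_exp.2
    nlinarith
  refine le_trans ?_ (h2.trans h3)
  norm_num [Nat.factorial]
  nlinarith [sq_nonneg L]

theorem two_rpow_logb {n : ℕ} (hn : 1 ≤ n) : (2 : ℝ) ^ Real.logb 2 n = n :=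
  Real.rpow_logb two_pos (by norm_num) (by exact_mod_cast hn)

/-- The union bound behind the isolated neighbour condition. -/
theorem union_bound {n k : ℕ} {s : ℝ} (hn : 1 ≤ n) (hs : s * s = n) (h4 : (4 : ℝ) ^ k ≤ s)
    (hk : 2 * k * Real.log n < s) :
    (1 - 1 / 4 ^ k : ℝ) ^ n * (n : ℝ) ^ (2 * k) < 1 := by
  have hn' : (0 : ℝ) < n := by exact_mod_cast hn
  have h40 : (0 : ℝ) < 4 ^ k := by positivity
  have h0 : (0 : ℝ) ≤ 1 - 1 / 4 ^ k := by
    rw [sub_nonneg, div_le_one h40]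
    exact one_le_pow₀ (by norm_num)
  have h1 : (1 - 1 / 4 ^ k : ℝ) ^ n ≤ Real.exp (-(n / 4 ^ k)) := by
    calc (1 - 1 / 4 ^ k : ℝ) ^ n ≤ Real.exp (-(1 / 4 ^ k)) ^ n := by
          gcongr
          linarith [Real.add_one_le_exp (-(1 / 4 ^ k : ℝ))]
      _ = _ := by
          rw [← Real.exp_nat_mul]
          congr 1
          ring
  have h2 : (n : ℝ) ^ (2 * k) = Real.exp (2 * k * Real.log n) := by
    rw [← Real.exp_log (pow_pos hn' (2 * k)), Real.log_pow]
    push_cast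
    rfl
  -- Here `s` is √n, so the exponent n / 4^k is at least √n and beats `2 * k * Real.log n`.
  have h3 : s ≤ n / 4 ^ k := by
    rw [le_div_iff₀ h40, ← hs]
    exact mul_le_mul_of_nonneg_left h4 (h40.le.trans h4)
  calc _ ≤ Real.exp (-(n / 4 ^ k)) * (n : ℝ) ^ (2 * k) := by gcongr
    _ = Real.exp (-(n / 4 ^ k) + 2 * k * Real.log n) := by rw [h2, Real.exp_add]
    _ < Real.exp 0 := Real.exp_lt_exp.2 (by linarith)
    _ = 1 := Real.exp_zero

/-- C(n,k) ≥ ((n + 1 - k) / k)^k, and n + 1 - k ≥ n / 2 ≥ k s. -/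
theorem pow_le_choose_of_mul_le {n k : ℕ} {s : ℝ} (hk : 1 ≤ k) (hkn : 2 * k ≤ n) (hs0 : 0 ≤ s)
    (hs : 2 * k * s ≤ n) : s ^ k ≤ n.choose k := by
  have h1 : ((n + 1 - k : ℕ) ^ k : ℝ) ≤ k.factorial * n.choose k := by
    rw [mul_comm, ← div_le_iff₀ (by positivity)]
    exact Nat.pow_le_choose k n
  have h2 : (k.factorial : ℝ) ≤ (k : ℝ) ^ k := by exact_mod_cast Nat.factorial_le_pow k
  have h3 : (s * k) ^ k ≤ ((n + 1 - k : ℕ) : ℝ) ^ k := by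
    gcongr
    have h5 : n ≤ 2 * (n + 1 - k) := by omega
    have h6 : (n : ℝ) ≤ 2 * ((n + 1 - k : ℕ) : ℝ) := by exact_mod_cast h5
    linarith
  have hk0 : (0 : ℝ) < (k : ℝ) ^ k := by
    have : (0 : ℝ) < k := by exact_mod_cast hk
    positivity
  rw [mul_pow] at h3
  have h4 : s ^ k * (k : ℝ) ^ k ≤ n.choose k * (k : ℝ) ^ k := by
    refine h3.trans (h1.trans ?_)
    rw [mul_comm]
    gcongr
  exact le_of_mul_le_mul_right h4 hk0

theorem three_halves_le_logb : (3 / 2 : ℝ) ≤ Real.logb 2 3 := by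
  rw [Real.le_logb_iff_rpow_le one_lt_two (by norm_num)]
  have h : ((2 : ℝ) ^ (3 / 2 : ℝ)) ^ 2 ≤ 3 ^ 2 := by
    rw [← Real.rpow_natCast, ← Real.rpow_mul (by norm_num)]
    norm_num
  exact le_of_sq_le_sq h (by norm_num)

/-- The slope 1/8 only has to stay below log 3 - 1. -/
theorem logb_two_le {x : ℝ} (hx : 0 < x) : Real.logb 2 x ≤ 4 + x / 8 := by
  have h1 : Real.logb 2 x = 4 + Real.logb 2 (x / 16) := by
    rw [Real.logb_div hx.ne' (by norm_num), show (16 : ℝ) = 2 ^ (4 : ℕ) by norm_num,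
      Real.logb_pow, Real.logb_self_eq_one one_lt_two]
    push_cast
    ring
  have h2 : Real.logb 2 (x / 16) ≤ x / 8 := by
    have h3 := Real.log_two_gt_d9
    rw [Real.logb, div_le_iff₀ (by linarith)]
    have := Real.log_le_sub_one_of_pos (show 0 < x / 16 by positivity)
    nlinarith
  linarith

end HazardFree

/-! ### Choice of constants and conclusion -/

theorem proposition1p19 :
    ∃ c₀ a C : ℝ, 0 < c₀ ∧ 0 < a ∧ 0 < C ∧
      ∀ c : ℝ, 0 < c → c ≤ c₀ →
      ∀ n k m : ℕ, k = ⌊c * Real.logb 2 (n : ℝ)⌋₊ → 1 ≤ k →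
        (∃ D : ℕ,
          HazardFree.hazardFreeDepth
            (HazardFree.blockComp (HazardFree.setCovering k n) (HazardFree.mux m)) = (D : ℕ∞) ∧
          Real.logb 2 ((3 : ℝ) ^ m) + Real.logb 2 (n.choose k : ℝ) ≤ (D : ℝ)) ∧
        Real.logb 2 3 * (m : ℝ) + a * (c * Real.logb 2 (n : ℝ) ^ 2) ≤
          Real.logb 2 ((3 : ℝ) ^ m) + Real.logb 2 (n.choose k : ℝ) ∧
        (C * Real.logb 2 (n : ℝ) ≤ (m : ℝ) →
          ∀ x : (Fin n × Fin n) × (Fin m ⊕ (Fin m → Bool)) → Bool,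
            ∃ d : ℕ,
              HazardFree.monotoneDepth
                (HazardFree.hazardDerivative
                  (HazardFree.blockComp (HazardFree.setCovering k n) (HazardFree.mux m)) x) =
                (d : ℕ∞) ∧
              (d : ℝ) < Real.logb 2 ((3 : ℝ) ^ m) + Real.logb 2 (n.choose k : ℝ)) := by
  -- With c₀ = 1/200, `1 ≤ k` forces L ≥ 200 and k ≤ L / 200, enough for all estimates.
  refine ⟨1 / 200, 1 / 4, 100, by norm_num, by norm_num, by norm_num, ?_⟩
  intro c hc hc0 n k m hk hk1
  set L := Real.logb 2 (n : ℝ) with hL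
  have hcL : 1 ≤ c * L := by
    rw [hk, Nat.one_le_floor_iff] at hk1
    exact hk1
  have hkL : (k : ℝ) ≤ c * L := hk ▸ Nat.floor_le (by linarith)
  have hkL' : c * L < k + 1 := hk ▸ Nat.lt_floor_add_one (c * L)
  have hk1' : (1 : ℝ) ≤ k := by exact_mod_cast hk1
  have hL0 : 0 < L := by
    by_contra! h
    nlinarith
  have hL200 : 200 ≤ L := by nlinarith
  have hkL'' : (k : ℝ) ≤ L / 200 := by nlinarith
  have hn : 1 ≤ n := by
    rcases Nat.eq_zero_or_pos n with h | h
    · simp [hL, h] at hL0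
    · exact h
  set s : ℝ := 2 ^ (L / 2) with hs
  have hLs : L ^ 2 ≤ s := HazardFree.sq_le_two_rpow_half hL200
  have hsn : s * s = n := by
    rw [hs, ← Real.rpow_add two_pos, add_halves, HazardFree.two_rpow_logb hn]
  have h2ks : (2 * k : ℝ) ≤ s := by nlinarith
  have hs1 : 1 ≤ s := by nlinarith
  have hkn : 2 * k ≤ n := by
    have : (2 * k : ℝ) ≤ n := by nlinarith
    exact_mod_cast this
  have h4 : (4 : ℝ) ^ k ≤ s := by
    rw [hs, show (4 : ℝ) = 2 ^ (2 : ℝ) by norm_num, ← Real.rpow_natCast, ← Real.rpow_mul two_pos.le]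
    exact Real.rpow_le_rpow_of_exponent_le one_le_two (by linarith)
  have hlog : Real.log n ≤ L := by
    have h1 : L * Real.log 2 = Real.log n := by
      rw [hL, Real.logb, div_mul_cancel₀ _ (Real.log_pos one_lt_two).ne']
    have h2 := Real.log_two_lt_d9
    nlinarith
  have hub := HazardFree.union_bound hn hsn h4 (by nlinarith)
  have hchoose : s ^ k ≤ n.choose k :=
    HazardFree.pow_le_choose_of_mul_le hk1 hkn (by linarith) (by nlinarith)
  have hch1 : 1 ≤ n.choose k := Nat.choose_pos (by omega)
  have hlogc : k * (L / 2) ≤ Real.logb 2 (n.choose k : ℝ) := by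
    rw [Real.le_logb_iff_rpow_le one_lt_two (by exact_mod_cast hch1), mul_comm,
      Real.rpow_mul two_pos.le, Real.rpow_natCast]
    exact hchoose
  have h3m : Real.logb 2 ((3 : ℝ) ^ m) = m * Real.logb 2 3 := Real.logb_pow _ _ _
  refine ⟨?_, ?_, fun hm x => ?_⟩
  · obtain ⟨D, hD, hle⟩ := HazardFree.exists_hazardFreeDepth_eq (m := m) hk1 hkn hub
    refine ⟨D, hD, ?_⟩
    have hch1' : (n.choose k : ℝ) ≠ 0 := by exact_mod_cast (by omega : n.choose k ≠ 0)
    rw [← Real.logb_mul (by positivity) hch1', Real.logb_le_iff_le_rpow one_lt_two (by positivity),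
      Real.rpow_natCast, mul_comm]
    exact_mod_cast hle
  · rw [h3m]
    -- From c L < k + 1 ≤ 2 k, the bound k L / 2 is at least c L² / 4, whence a = 1/4.
    nlinarith
  · obtain ⟨d, hd, hle⟩ := HazardFree.exists_monotoneDepth_eq hk1 (by omega) x
    refine ⟨d, hd, ?_⟩
    have hle' : (d : ℝ) ≤ Nat.clog 2 (m + 1) + m + Nat.clog 2 n + Nat.clog 2 n +
        Nat.clog 2 (n.choose k) := by
      have := Nat.clog_mono_right 2 (show k ≤ n by omega)
      exact_mod_cast hle.trans (by omega)
    have h1 := HazardFree.clog_two_le (x := m + 1) (by omega)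
    have h2 := HazardFree.clog_two_le hn
    have h3 := HazardFree.clog_two_le hch1
    have h5 := HazardFree.logb_two_le (x := ((m + 1 : ℕ) : ℝ)) (by positivity)
    have h6 : (m : ℝ) * (3 / 2) ≤ m * Real.logb 2 3 := by
      gcongr
      exact HazardFree.three_halves_le_logb
    rw [h3m]
    push_cast at h1 h5
    -- The depth is at most 9m/8 + 2L + 9 + log C(n,k), while the rank bound is at least 3m/2 + log
    -- C(n,k); m ≥ 100 L leaves ample room.
    linarith
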